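/- Let $\Gamma\subseteq\mathbb N=\{0,1,2,\dots\}$ be a numerical semigroup, i.e. an additive submonoid of $\mathbb N$ whose elements have greatest common divisor $1$, and let $n_1<\dots<n_r$ be its minimal generating set. For $n\in\mathbb N$ let $$\mathsf L(n)=\{a_1+\cdots+a_r : (a_1,\dots,a_r)\in\mathbb N^r,\ a_1n_1+\cdots+a_rn_r=n\}$$ be the set of factorization lengths of $n$. Writing $\mathsf L(n)=\{\ell_1<\cdots<\ell_m\}$, put $\Delta(n)=\{\ell_{i+1}-\ell_i : 1\le i<m\}$, and let $\Delta(\Gamma)=\bigcup_{n\in\Gamma}\Delta(n)$. Then there exist a constant $a_1\in\mathbb Q$ and a periodic function $a_0:\mathbb N\to\mathbb Q$, whose (minimal positive) period divides $\operatorname{lcm}(n_1,n_r)$, such that $$|\mathsf L(n)| = a_1 n + a_0(n)\qquad\text{for all sufficiently large } n.$$ Moreover, if $\Gamma\neq\mathbb N$, then $\Delta(\Gamma)\neq\emptyset$ and, with $g=\min\Delta(\Gamma)$, $$a_1=\frac{n_r-n_1}{g\,n_1\,n_r}.$$ -/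

import Mathlib

open Filter

namespace NumericalFactorization

/-- A numerical semigroup: an additive submonoid of `ℕ` whose elements have greatest common
divisor `1`. -/
def IsNumericalSemigroup (Γ : AddSubmonoid ℕ) : Prop :=
  Nat.setGcd (Γ : Set ℕ) = 1

/-- `n` lists, in increasing order, a generating set of `Γ` which is minimal, i.e. no proper
subset of it generates `Γ`. -/
structure IsMinimalGenerators {r : ℕ} (Γ : AddSubmonoid ℕ) (n : Fin r → ℕ) : Prop where
  strictMono : StrictMono n
  closure_eq : AddSubmonoid.closure (Set.range n) = Γ
  minimal : ∀ S : Set ℕ, S ⊂ Set.range n → AddSubmonoid.closure S ≠ Γ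

/-- The set `Z(x)` of factorizations `x = a₁ n₁ + ⋯ + aᵣ nᵣ`, as a subset of `ℕ ^ r`. -/
def factorizations {r : ℕ} (n : Fin r → ℕ) (x : ℕ) : Set (Fin r → ℕ) :=
  {a | ∑ i, a i * n i = x}

/-- The length set `L(x) = {a₁ + ⋯ + aᵣ : a ∈ Z(x)}`. -/
def lengthSet {r : ℕ} (n : Fin r → ℕ) (x : ℕ) : Set ℕ :=
  (fun a => ∑ i, a i) '' factorizations n x

/-- The length set is finite when all generators are positive, so its `Set.ncard` is its
cardinality. -/
theorem lengthSet_finite {r : ℕ} (n : Fin r → ℕ) (hn : ∀ i, 0 < n i) (x : ℕ) :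
    (lengthSet n x).Finite := by
  refine (Set.finite_Iic x).subset ?_
  rintro _ ⟨a, ha, rfl⟩
  have ha' : ∑ i, a i * n i = x := ha
  rw [Set.mem_Iic, ← ha']
  exact Finset.sum_le_sum fun i _ => Nat.le_mul_of_pos_right _ (hn i)

/-- The delta set `Δ(x)` of an element: the differences of successive elements of `L(x)`. -/
def deltaSetElem {r : ℕ} (n : Fin r → ℕ) (x : ℕ) : Set ℕ :=
  {d | ∃ l ∈ lengthSet n x, ∃ l' ∈ lengthSet n x,
    l < l' ∧ (∀ m ∈ lengthSet n x, ¬ (l < m ∧ m < l')) ∧ d = l' - l}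

/-- The delta set `Δ(Γ)`: the union of the delta sets of the elements of `Γ`. -/
def deltaSet {r : ℕ} (Γ : AddSubmonoid ℕ) (n : Fin r → ℕ) : Set ℕ :=
  ⋃ x ∈ Γ, deltaSetElem n x

/-- `p` is the period of `f`: the least positive integer with `f (x + p) = f x` for all `x`. -/
def IsPeriod (f : ℕ → ℚ) (p : ℕ) : Prop :=
  IsLeast {q : ℕ | 0 < q ∧ ∀ x, f (x + q) = f x} p

end NumericalFactorization

namespace NumericalFactorization

open Finset

/-! Let `g` be the gcd of the differences `n i - n 0`; it is coprime to `n 0`, so all lengths of `x`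
lie in one class mod `g`. Conversely, every length of that class in `[x / n k, x / n 0]` occurs,
except near the ends (`IsDifferenceGcd.mem_lengthSet`). Write `lcm (n 0) (n k) = a * n 0 = b * n k`.
For large `x`, the length set of `x + lcm` is the lower part of that of `x` shifted by `b`, the
upper part shifted by `a`, and a full middle window with `(a - b) / g` new lengths
(`ncard_lengthSet_add`). This recursion gives the slope and the periodic term. -/

theorem mem_lengthSet {r : ℕ} {n : Fin r → ℕ} {x l : ℕ} :
    l ∈ lengthSet n x ↔ ∃ a : Fin r → ℕ, ∑ i, a i * n i = x ∧ ∑ i, a i = l :=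
  Iff.rfl

/-- `g` is the greatest common divisor of the differences of the generators and it is coprime
to the generators, in a form convenient for computations. -/
structure IsDifferenceGcd {k : ℕ} (n : Fin (k + 1) → ℕ) (g : ℕ) : Prop where
  pos : 0 < g
  dvd : ∀ i, (g : ℤ) ∣ (n i : ℤ) - n 0
  bezout : ∃ z : Fin (k + 1) → ℤ, ∑ i, ((n i : ℤ) - n 0) * z i = g
  coprime : IsCoprime (g : ℤ) (n 0 : ℤ)

/-! ### Trading for the extreme generators -/

section

variable {k : ℕ} {n : Fin (k + 1) → ℕ}

theorem mem_lengthSet_of_sum_add (c : Fin (k + 1) → ℕ) (s t x l : ℕ)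
    (hx : ∑ i, c i * n i + s * n 0 + t * n (Fin.last k) = x) (hl : ∑ i, c i + s + t = l) :
    l ∈ lengthSet n x := by
  refine mem_lengthSet.2 ⟨fun i => c i + (Pi.single 0 s : Fin (k + 1) → ℕ) i +
    (Pi.single (Fin.last k) t : Fin (k + 1) → ℕ) i, ?_, ?_⟩
  · rw [← hx]
    simp [add_mul, sum_add_distrib, Pi.single_apply, ite_mul]
  · rw [← hl]
    simp [sum_add_distrib, Pi.single_apply]

/-- The coefficients of a factorization can be reduced modulo `n k - n 0`, because `n k - n 0`
copies of `n i` can be traded for copies of the extreme generators. -/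
theorem exists_reduced_of_mem_lengthSet (hn : Monotone n) (hlt : n 0 < n (Fin.last k))
    {x l : ℕ} (h : l ∈ lengthSet n x) :
    ∃ (c : Fin (k + 1) → ℕ) (s t : ℕ), (∀ i, c i < n (Fin.last k) - n 0) ∧
      ∑ i, c i * n i + s * n 0 + t * n (Fin.last k) = x ∧ ∑ i, c i + s + t = l := by
  obtain ⟨a, rfl, rfl⟩ := mem_lengthSet.1 h
  set D := n (Fin.last k) - n 0 with hD
  have hDpos : 0 < D := by omega
  -- The trade is `D * n i = (n k - n i) * n 0 + (n i - n 0) * n k`; it keeps the length, as the two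
  -- coefficients add up to `D`.
  refine ⟨fun i => a i % D, ∑ i, a i / D * (n (Fin.last k) - n i), ∑ i, a i / D * (n i - n 0),
    fun i => Nat.mod_lt _ hDpos, ?_, ?_⟩
  · rw [sum_mul, sum_mul, ← sum_add_distrib, ← sum_add_distrib]
    refine sum_congr rfl fun i _ => ?_
    obtain ⟨d, hd⟩ := Nat.exists_eq_add_of_le (hn (Fin.zero_le i))
    obtain ⟨e, he⟩ := Nat.exists_eq_add_of_le (hn (Fin.le_last i))
    have hDe : D = d + e := by omega
    have h1 : n i - n 0 = d := by omega
    have h2 : n (Fin.last k) - n i = e := by omega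
    rw [h1, h2]
    beta_reduce
    conv_rhs => rw [← Nat.mod_add_div (a i) D]
    rw [he, hd]
    generalize a i % D = u
    generalize a i / D = v
    rw [hDe]
    ring
  · rw [← sum_add_distrib, ← sum_add_distrib]
    refine sum_congr rfl fun i _ => ?_
    have h1 : n 0 ≤ n i := hn (Fin.zero_le i)
    have h2 : n i ≤ n (Fin.last k) := hn (Fin.le_last i)
    have h3 : n (Fin.last k) - n i + (n i - n 0) = D := by omega
    rw [add_assoc, ← mul_add, h3, mul_comm, Nat.mod_add_div]

theorem sum_mul_le_of_le {D : ℕ} (c w : Fin (k + 1) → ℤ) (hc₀ : ∀ i, 0 ≤ c i)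
    (hc : ∀ i, c i ≤ D) (hw : ∀ i, w i ≤ D) :
    ∑ i, c i * w i ≤ (k + 1) * D * D := by
  have : ∀ i ∈ (univ : Finset (Fin (k + 1))), c i * w i ≤ (D : ℤ) * D := fun i _ =>
    (mul_le_mul_of_nonneg_left (hw i) (hc₀ i)).trans
      (mul_le_mul_of_nonneg_right (hc i) (Int.natCast_nonneg D))
  have h := sum_le_card_nsmul _ _ _ this
  simp only [card_univ, Fintype.card_fin, nsmul_eq_mul] at h
  push_cast at h
  linarith

/-- A length which is not close to the minimal length is realized by a factorization using the
smallest generator at least `a` times. -/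
theorem exists_sub_smallest (hn : Monotone n) (hlt : n 0 < n (Fin.last k)) {D : ℕ}
    (hD : n (Fin.last k) = n 0 + D) {y l a : ℕ} (h : l ∈ lengthSet n y)
    (hl : y + ((k + 1) * D * D + D * a) ≤ l * n (Fin.last k)) :
    ∃ x m, x + a * n 0 = y ∧ m + a = l ∧ m ∈ lengthSet n x := by
  obtain ⟨c, s, t, hc, rfl, rfl⟩ := exists_reduced_of_mem_lengthSet hn hlt h
  -- Here `l * n k - y = ∑ c i * (n k - n i) + s * D`, and the sum is at most `(k + 1) * D * D`.
  have hs : a ≤ s := by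
    have hb := sum_mul_le_of_le (D := D) (fun i => (c i : ℤ)) (fun i => n (Fin.last k) - n i)
      (fun i => Int.natCast_nonneg _) (fun i => by have := hc i; omega)
      (fun i => by have := hn (Fin.zero_le i); omega)
    simp only [mul_sub, sum_sub_distrib, ← sum_mul] at hb
    have hDpos : (0 : ℤ) < D := by omega
    zify at hl hD ⊢
    rw [hD] at hl hb
    refine le_of_mul_le_mul_left ?_ hDpos
    linarith
  obtain ⟨s, rfl⟩ := Nat.exists_eq_add_of_le hs
  exact ⟨_, _, by ring, by ring, mem_lengthSet_of_sum_add c s t _ _ rfl rfl⟩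

/-- A length which is not close to the maximal length is realized by a factorization using the
largest generator at least `b` times. -/
theorem exists_sub_largest (hn : Monotone n) (hlt : n 0 < n (Fin.last k)) {D : ℕ}
    (hD : n (Fin.last k) = n 0 + D) {y l b : ℕ} (h : l ∈ lengthSet n y)
    (hl : l * n 0 + ((k + 1) * D * D + D * b) ≤ y) :
    ∃ x m, x + b * n (Fin.last k) = y ∧ m + b = l ∧ m ∈ lengthSet n x := by
  obtain ⟨c, s, t, hc, rfl, rfl⟩ := exists_reduced_of_mem_lengthSet hn hlt h
  have ht : b ≤ t := by
    have hb := sum_mul_le_of_le (D := D) (fun i => (c i : ℤ)) (fun i => n i - n 0)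
      (fun i => Int.natCast_nonneg _) (fun i => by have := hc i; omega)
      (fun i => by have := hn (Fin.le_last i); omega)
    simp only [mul_sub, sum_sub_distrib, ← sum_mul] at hb
    have hDpos : (0 : ℤ) < D := by omega
    zify at hl hD ⊢
    rw [hD] at hl
    refine le_of_mul_le_mul_left ?_ hDpos
    linarith
  obtain ⟨t, rfl⟩ := Nat.exists_eq_add_of_le ht
  exact ⟨_, _, by ring, by ring, mem_lengthSet_of_sum_add c s t _ _ rfl rfl⟩

/-! ### Lengths modulo `g` -/

variable {g : ℕ}

theorem IsDifferenceGcd.dvd_sub_mul (hg : IsDifferenceGcd n g) {x l : ℕ}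
    (h : l ∈ lengthSet n x) : (g : ℤ) ∣ x - l * n 0 := by
  obtain ⟨a, rfl, rfl⟩ := mem_lengthSet.1 h
  push_cast
  rw [sum_mul, ← sum_sub_distrib]
  refine dvd_sum fun i _ => ?_
  rw [← mul_sub]
  exact (hg.dvd i).mul_left _

theorem IsDifferenceGcd.dvd_sub (hg : IsDifferenceGcd n g) {x l m : ℤ}
    (hl : (g : ℤ) ∣ x - l * n 0) (hm : (g : ℤ) ∣ x - m * n 0) : (g : ℤ) ∣ m - l := by
  refine hg.coprime.dvd_of_dvd_mul_right ?_
  have := hl.sub hm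
  rwa [show x - l * n 0 - (x - m * n 0) = (m - l) * n 0 by ring] at this

/-- Away from the extreme lengths, all lengths in the right residue class occur. -/
theorem IsDifferenceGcd.mem_lengthSet (hg : IsDifferenceGcd n g) (hn : Monotone n)
    (hlt : n 0 < n (Fin.last k)) {D : ℕ} (hD : n (Fin.last k) = n 0 + D) {y l : ℕ}
    (hmod : (g : ℤ) ∣ y - l * n 0) (h₀ : l * n 0 + (k + 1) * D * D ≤ y)
    (h₁ : y + (k + 1) * D * D ≤ l * n (Fin.last k)) : l ∈ lengthSet n y := by
  obtain ⟨p, hp⟩ := hmod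
  obtain ⟨z, hz⟩ := hg.bezout
  have hDpos : (0 : ℤ) < D := by omega
  -- The integers `z i * p` solve `∑ z i * p * (n i - n 0) = y - l * n 0`. Reducing them mod `D`
  -- leaves a multiple `D * j`, supplied by `j` copies of `n k`; copies of `n 0` then fill the
  -- length up to `l`. The bounds `h₀` and `h₁` make both counts nonnegative.
  set c : Fin (k + 1) → ℤ := fun i => (z i * p) % D with hc
  have hc₀ : ∀ i, 0 ≤ c i := fun i => Int.emod_nonneg _ hDpos.ne'
  have hcD : ∀ i, c i ≤ D := fun i => (Int.emod_lt_of_pos _ hDpos).le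
  have hsum : ∑ i, c i * ((n i : ℤ) - n 0) + D * ∑ i, (z i * p) / D * ((n i : ℤ) - n 0)
      = y - l * n 0 := by
    rw [hp, ← hz, mul_sum, sum_mul, ← sum_add_distrib]
    refine sum_congr rfl fun i _ => ?_
    have := Int.emod_add_mul_ediv (z i * p) D
    calc _ = ((z i * p) % D + D * (z i * p / D)) * ((n i : ℤ) - n 0) := by rw [hc]; ring
      _ = _ := by rw [this]; ring
  set j := ∑ i, (z i * p) / D * ((n i : ℤ) - n 0)
  have hb₀ := sum_mul_le_of_le (D := D) c (fun i => n i - n 0) hc₀ hcD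
    (fun i => by have := hn (Fin.le_last i); omega)
  have hb₁ := sum_mul_le_of_le (D := D) c (fun i => n (Fin.last k) - n i) hc₀ hcD
    (fun i => by have := hn (Fin.zero_le i); omega)
  simp only [mul_sub, sum_sub_distrib, ← sum_mul] at hb₀ hb₁ hsum
  zify at hD h₀ h₁
  rw [hD] at h₁ hb₁
  have hj : 0 ≤ j := by
    refine le_of_mul_le_mul_left ?_ hDpos
    linarith
  have hs : 0 ≤ l - ∑ i, c i - j := by
    refine le_of_mul_le_mul_left ?_ hDpos
    linarith
  obtain ⟨t, ht⟩ := Int.eq_ofNat_of_zero_le hj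
  obtain ⟨s, hs⟩ := Int.eq_ofNat_of_zero_le hs
  clear_value c
  clear hc
  lift c to Fin (k + 1) → ℕ using hc₀
  refine mem_lengthSet_of_sum_add c s t y l ?_ ?_
  · zify
    rw [hD, ← hs, ← ht]
    linarith
  · zify
    rw [← hs, ← ht]
    ring

/-! ### Counting lengths -/

theorem add_mem_lengthSet {x l a : ℕ} (i : Fin (k + 1)) (h : l ∈ lengthSet n x) :
    l + a ∈ lengthSet n (x + a * n i) := by
  obtain ⟨c, rfl, rfl⟩ := NumericalFactorization.mem_lengthSet.1 h
  refine NumericalFactorization.mem_lengthSet.2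
    ⟨fun j => c j + (Pi.single i a : Fin (k + 1) → ℕ) j, ?_, ?_⟩
  · simp [add_mul, sum_add_distrib, Pi.single_apply, ite_mul]
  · simp [sum_add_distrib, Pi.single_apply]

/-- Since `n 0` is invertible mod `g`, the condition selects one residue class, which meets each `g`
consecutive integers once. -/
theorem card_filter_dvd_sub_mul (hg : IsDifferenceGcd n g) (y u m : ℕ) :
    #{l ∈ Ico u (u + g * m) | ((g : ℤ) ∣ (y : ℤ) - (l : ℕ) * n 0)} = m := by
  obtain ⟨α, β, hαβ⟩ := hg.coprime
  have hg0 : (0 : ℤ) < g := by exact_mod_cast hg.pos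
  obtain ⟨v, hv⟩ := Int.eq_ofNat_of_zero_le (Int.emod_nonneg (y * β) hg0.ne')
  have hvy : (g : ℤ) ∣ y - v * n 0 := by
    have h := Int.emod_add_mul_ediv (y * β) g
    rw [hv] at h
    refine ⟨y * α + ((y : ℤ) * β / g) * n 0, ?_⟩
    linear_combination (y : ℤ) * (-hαβ) - (n 0 : ℤ) * h
  have hiff : ∀ l : ℕ, (g : ℤ) ∣ (y : ℤ) - l * n 0 ↔ l ≡ v [MOD g] := by
    intro l
    rw [Nat.ModEq.comm, Nat.modEq_iff_dvd]
    refine ⟨fun h => hg.dvd_sub hvy h, fun h => ?_⟩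
    have := hvy.sub (h.mul_right (n 0 : ℤ))
    rwa [show (y : ℤ) - v * n 0 - (l - v) * n 0 = y - l * n 0 by ring] at this
  simp only [hiff]
  zify
  rw [Nat.Ico_filter_modEq_card _ _ hg.pos]
  have hgq : (g : ℚ) ≠ 0 := by exact_mod_cast hg.pos.ne'
  have : (((u + g * m : ℕ) : ℚ) - v) / g = ((u : ℚ) - v) / g + (m : ℕ) := by
    push_cast
    field_simp
    ring
  rw [this, Int.ceil_add_natCast]
  simp

/-- The recursion for the number of lengths: passing from `x` to `x + a n₀ = x + b nₖ` adds
`(a - b) / g` lengths, for `x` large. -/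
theorem ncard_lengthSet_add (hg : IsDifferenceGcd n g) (hn : Monotone n) (h0 : 0 < n 0)
    (hlt : n 0 < n (Fin.last k)) {a b m : ℕ} (hab : a * n 0 = b * n (Fin.last k))
    (hm : a = b + g * m) :
    ∃ N, ∀ x ≥ N, (lengthSet n (x + a * n 0)).ncard = (lengthSet n x).ncard + m := by
  classical
  obtain ⟨D, hD⟩ := Nat.exists_eq_add_of_le hlt.le
  have hpos : ∀ i, 0 < n i := fun i => h0.trans_le (hn (Fin.zero_le i))
  set C := (k + 1) * D * D + D * a with hC
  have hDpos : 0 < D := by omega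
  refine ⟨n 0 * (2 * C + n 0 + D) + D * C + C, fun x hx => ?_⟩
  -- The cut `T` is far from both extreme lengths of `x`. Taking it just above `(x + C) / n k`, the
  -- second inequality follows from `D * x ≥ n 0 * (2 * C + n 0 + D) + D * C`.
  obtain ⟨T, hT₁, hT₀⟩ : ∃ T, x + C ≤ T * n (Fin.last k) ∧ T * n 0 + C ≤ x := by
    refine ⟨(x + C) / n (Fin.last k) + 1, ?_, ?_⟩
    · have := Nat.lt_div_mul_add (a := x + C) (hpos (Fin.last k))
      rw [add_mul, one_mul]
      omega
    · have h := Nat.div_mul_le_self (x + C) (n (Fin.last k))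
      generalize (x + C) / n (Fin.last k) = q at h ⊢
      refine le_of_mul_le_mul_right ?_ (hpos (Fin.last k))
      rw [hD] at h ⊢
      nlinarith [Nat.mul_le_mul_left (n 0) h, Nat.mul_le_mul_left D hx]
  have hCb : (k + 1) * D * D + D * b ≤ C := by
    rw [hC]; gcongr; omega
  have hC0 : (k + 1) * D * D ≤ C := by rw [hC]; omega
  have hfin : ∀ y, ∃ A : Finset ℕ, ∀ l, l ∈ A ↔ l ∈ lengthSet n y := fun y =>
    ⟨(lengthSet_finite n hpos y).toFinset, fun l => by simp⟩
  obtain ⟨A, hA⟩ := hfin x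
  obtain ⟨B, hB⟩ := hfin (x + a * n 0)
  have hAc : (lengthSet n x).ncard = #A := by
    rw [← Set.ncard_coe_finset]; congr; ext l; simp [hA]
  have hBc : (lengthSet n (x + a * n 0)).ncard = #B := by
    rw [← Set.ncard_coe_finset]; congr; ext l; simp [hB]
  -- Lengths below the window allow removing `b` copies of `n k`; those above it, `a` copies of `n
  -- 0`.
  have hlow : {l ∈ B | l < T + b} = {l ∈ A | l < T}.map (addRightEmbedding b) := by
    ext l
    simp only [mem_filter, Finset.mem_map, addRightEmbedding_apply, hA, hB]
    constructor
    · rintro ⟨hl, hlT⟩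
      obtain ⟨x', l', hx', rfl, hl'⟩ := exists_sub_largest (b := b) hn hlt hD hl (by
        rw [hab]
        have h1 := Nat.mul_le_mul_right (n 0) hlT.le
        have h2 := Nat.mul_le_mul_left b hlt.le
        linarith)
      obtain rfl : x' = x := by omega
      exact ⟨l', ⟨hl', by omega⟩, rfl⟩
    · rintro ⟨l', ⟨hl', hlT⟩, rfl⟩
      exact ⟨hab ▸ add_mem_lengthSet _ hl', by omega⟩
  have hupp : {l ∈ B | T + a ≤ l} = {l ∈ A | ¬ l < T}.map (addRightEmbedding a) := by
    ext l
    simp only [mem_filter, Finset.mem_map, addRightEmbedding_apply, hA, hB]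
    constructor
    · rintro ⟨hl, hlT⟩
      obtain ⟨x', l', hx', rfl, hl'⟩ := exists_sub_smallest (a := a) hn hlt hD hl (by
        have h1 := Nat.mul_le_mul_right (n (Fin.last k)) hlT
        have h2 := Nat.mul_le_mul_left a hlt.le
        linarith)
      obtain rfl : x' = x := by omega
      exact ⟨l', ⟨hl', by omega⟩, rfl⟩
    · rintro ⟨l', ⟨hl', hlT⟩, rfl⟩
      exact ⟨add_mem_lengthSet _ hl', by omega⟩
  have hmid : {l ∈ B | ¬ l < T + b ∧ ¬ T + a ≤ l} =
      {l ∈ Ico (T + b) (T + b + g * m) |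
        ((g : ℤ) ∣ ((x + a * n 0 : ℕ) : ℤ) - (l : ℕ) * n 0)} := by
    ext l
    simp only [mem_filter, mem_Ico, hB]
    constructor
    · rintro ⟨hl, h1, h2⟩
      exact ⟨⟨by omega, by omega⟩, hg.dvd_sub_mul hl⟩
    · rintro ⟨⟨h1, h2⟩, h3⟩
      refine ⟨hg.mem_lengthSet hn hlt hD h3 ?_ ?_, by omega, by omega⟩
      · have h4 : l ≤ T + a := by omega
        have := Nat.mul_le_mul_right (n 0) h4
        linarith
      · have := Nat.mul_le_mul_right (n (Fin.last k)) h1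
        rw [hab]
        linarith
  have hc1 := card_filter_add_card_filter_not (s := A) (fun l => l < T)
  have hc2 := card_filter_add_card_filter_not (s := B) (fun l => l < T + b)
  have hc3 := card_filter_add_card_filter_not (s := {l ∈ B | ¬ l < T + b})
    (fun l => T + a ≤ l)
  rw [filter_filter, filter_filter, hmid, card_filter_dvd_sub_mul hg] at hc3
  have hc4 : {l ∈ B | ¬ l < T + b ∧ T + a ≤ l} = {l ∈ B | T + a ≤ l} := by
    refine filter_congr fun l _ => ?_
    omega
  rw [hc4, hupp, card_map] at hc3
  rw [hlow, card_map] at hc2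
  rw [hAc, hBc]
  omega

/-! ### The minimum of the delta set -/

theorem mem_closure_of_mem_lengthSet {x l : ℕ} (h : l ∈ lengthSet n x) :
    x ∈ AddSubmonoid.closure (Set.range n) := by
  obtain ⟨a, rfl, rfl⟩ := mem_lengthSet.1 h
  refine sum_mem fun i _ => ?_
  rw [← smul_eq_mul]
  exact nsmul_mem (AddSubmonoid.subset_closure (Set.mem_range_self i)) _

theorem isLeast_deltaSet {Γ : AddSubmonoid ℕ} (hΓ : AddSubmonoid.closure (Set.range n) = Γ)
    (hg : IsDifferenceGcd n g) (hn : Monotone n) (hlt : n 0 < n (Fin.last k)) :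
    IsLeast (deltaSet Γ n) g := by
  have key : ∀ x, ∀ l ∈ lengthSet n x, ∀ l' ∈ lengthSet n x, l < l' → g ≤ l' - l := by
    intro x l hl l' hl' hll
    have h := hg.dvd_sub (hg.dvd_sub_mul hl) (hg.dvd_sub_mul hl')
    have := Int.le_of_dvd (by omega) h
    omega
  constructor
  · obtain ⟨D, hD⟩ := Nat.exists_eq_add_of_le hlt.le
    have hDpos : 0 < D := by omega
    have hgpos := hg.pos
    set C := (k + 1) * D * D with hC
    -- For `y = l * n 0 + g * q`, this `q` keeps `l + g` away from the top of the length range, and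
    -- `l = C + g * q` keeps `l` away from the bottom, so both occur.
    set q := C + n 0 with hq
    set l := C + g * q with hl
    have hCg : C ≤ C * g := Nat.le_mul_of_pos_right _ hgpos
    have hlD : l ≤ l * D := Nat.le_mul_of_pos_right _ hDpos
    have hqg : g * q = C * g + g * n 0 := by rw [hq]; ring
    have h1 : l ∈ lengthSet n (l * n 0 + g * q) := by
      refine hg.mem_lengthSet hn hlt hD ⟨q, by push_cast; ring⟩ ?_ ?_
      · omega
      · rw [hD, mul_add l]
        omega
    have h2 : l + g ∈ lengthSet n (l * n 0 + g * q) := by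
      refine hg.mem_lengthSet hn hlt hD ⟨q - n 0, by push_cast; ring⟩ ?_ ?_
      · rw [add_mul]
        omega
      · rw [hD, mul_add (l + g), add_mul l g (n 0), add_mul l g D]
        omega
    simp only [deltaSet, Set.mem_iUnion]
    refine ⟨_, hΓ ▸ mem_closure_of_mem_lengthSet h1, l, h1, l + g, h2, by omega, ?_, by omega⟩
    rintro m hm ⟨hm1, hm2⟩
    have := key _ l h1 m hm hm1
    omega
  · rintro d hd
    simp only [deltaSet, Set.mem_iUnion] at hd
    obtain ⟨x, -, l, hl, l', hl', hll, -, rfl⟩ := hd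
    exact key x l hl l' hl' hll

end

/-! ### Eventually quasi-linear functions -/

theorem exists_isPeriod_dvd {f : ℕ → ℚ} {q : ℕ} (hq : 0 < q) (hf : ∀ x, f (x + q) = f x) :
    ∃ p, IsPeriod f p ∧ p ∣ q := by
  classical
  have hex : ∃ p, 0 < p ∧ ∀ x, f (x + p) = f x := ⟨q, hq, hf⟩
  obtain ⟨hp, hfp⟩ := Nat.find_spec hex
  have hmin : ∀ r, (0 < r ∧ ∀ x, f (x + r) = f x) → Nat.find hex ≤ r := fun r => Nat.find_min' hex
  generalize Nat.find hex = p at hp hfp hmin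
  refine ⟨p, ⟨⟨hp, hfp⟩, hmin⟩, Nat.dvd_of_mod_eq_zero ?_⟩
  by_contra hr
  have hmul : ∀ m x, f (x + p * m) = f x := by
    intro m
    induction m with
    | zero => simp
    | succ m ih => intro x; rw [mul_add, mul_one, ← add_assoc, hfp, ih]
  -- A nonzero remainder `q % p` would be a period smaller than `p`.
  refine (Nat.mod_lt q hp).not_ge (hmin _ ⟨Nat.pos_of_ne_zero hr, fun x => ?_⟩)
  rw [← hmul (q / p), add_assoc, Nat.mod_add_div, hf]

/-- An eventually quasi-linear function: if `F (x + q) = F x + c q` for large `x`, then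
`F x - c x` eventually agrees with a periodic function whose period divides `q`. -/
theorem exists_periodic_of_eventually_add {F : ℕ → ℚ} {c : ℚ} {q N : ℕ} (hq : 0 < q)
    (hF : ∀ x ≥ N, F (x + q) = F x + c * q) :
    ∃ a₀ : ℕ → ℚ, (∃ p, IsPeriod a₀ p ∧ p ∣ q) ∧
      ∀ᶠ x : ℕ in Filter.atTop, F x = c * x + a₀ x := by
  have hmul : ∀ m, ∀ x ≥ N, F (x + m * q) = F x + c * (m * q) := by
    intro m
    induction m with
    | zero => simp
    | succ m ih =>
      intro x hx
      rw [add_mul, one_mul, ← add_assoc, hF _ (by omega), ih x hx]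
      push_cast
      ring
  -- The shift by `N * q` moves every `x` past the threshold `N`, so periodicity holds everywhere.
  refine ⟨fun x => F (x + N * q) - c * (x + N * q), exists_isPeriod_dvd hq fun x => ?_, ?_⟩
  · have hN : N ≤ N * q := Nat.le_mul_of_pos_right _ hq
    rw [add_right_comm, hF _ (by omega)]
    push_cast
    ring
  · filter_upwards [Filter.eventually_ge_atTop N] with x hx
    rw [hmul N x hx]
    ring

/-! ### Minimal generators and their gcd -/

theorem IsMinimalGenerators.pos {r : ℕ} {Γ : AddSubmonoid ℕ} {n : Fin r → ℕ}
    (hn : IsMinimalGenerators Γ n) (i : Fin r) : 0 < n i := by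
  by_contra h
  have h0 : (0 : ℕ) ∈ Set.range n := ⟨i, by omega⟩
  refine hn.minimal (Set.range n \ {0}) ⟨Set.sdiff_subset, fun h => (h h0).2 rfl⟩ ?_
  rw [AddSubmonoid.closure_sdiff_singleton_zero, hn.closure_eq]

theorem eq_one_of_forall_dvd {r : ℕ} {Γ : AddSubmonoid ℕ} {n : Fin r → ℕ}
    (hΓ : IsNumericalSemigroup Γ) (hn : IsMinimalGenerators Γ n) {d : ℕ} (hd : ∀ i, d ∣ n i) :
    d = 1 := by
  rw [← Nat.dvd_one, ← hΓ, Nat.dvd_setGcd_iff]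
  intro m hm
  rw [← hn.closure_eq] at hm
  refine (Nat.dvd_setGcd_iff.2 ?_).trans (Nat.setGcd_dvd_of_mem_closure hm)
  rintro _ ⟨i, rfl⟩
  exact hd i

theorem exists_isDifferenceGcd {k : ℕ} {Γ : AddSubmonoid ℕ} {n : Fin (k + 1) → ℕ}
    (hΓ : IsNumericalSemigroup Γ) (hn : IsMinimalGenerators Γ n) (hlt : n 0 < n (Fin.last k)) :
    ∃ g, IsDifferenceGcd n g := by
  obtain ⟨g, hg⟩ := Int.eq_ofNat_of_zero_le
    (Int.finsetGcd_nonneg (s := univ) (f := fun i => (n i : ℤ) - n 0))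
  have hdvd : ∀ i, (g : ℤ) ∣ (n i : ℤ) - n 0 := fun i => hg ▸ gcd_dvd (mem_univ i)
  refine ⟨g, Nat.pos_of_ne_zero ?_, hdvd, ?_, ?_⟩
  · rintro rfl
    have := zero_dvd_iff.1 (hdvd (Fin.last k))
    omega
  · obtain ⟨z, hz⟩ := gcd_eq_sum_mul univ (fun i => (n i : ℤ) - n 0)
    exact ⟨z, hz.symm.trans hg⟩
  · rw [Nat.isCoprime_iff_coprime]
    -- A common divisor of `g` and `n 0` divides every `n i`.
    refine eq_one_of_forall_dvd hΓ hn fun i => ?_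
    have h1 : (Nat.gcd g (n 0) : ℤ) ∣ (n i : ℤ) - n 0 :=
      (Int.natCast_dvd_natCast.2 (Nat.gcd_dvd_left g (n 0))).trans (hdvd i)
    have h2 := h1.add (Int.natCast_dvd_natCast.2 (Nat.gcd_dvd_right g (n 0)))
    rw [sub_add_cancel] at h2
    exact Int.natCast_dvd_natCast.1 h2

end NumericalFactorization

open NumericalFactorization
theorem mainTheorem12 (Γ : AddSubmonoid ℕ)
    (hΓ : NumericalFactorization.IsNumericalSemigroup Γ)
    -- the number of minimal generators is `r = k + 1`; they are `n 0 < ⋯ < n (Fin.last k)`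
    (k : ℕ) (n : Fin (k + 1) → ℕ)
    (hn : NumericalFactorization.IsMinimalGenerators Γ n) :
    ∃ (a₁ : ℚ) (a₀ : ℕ → ℚ),
      (∃ p : ℕ, NumericalFactorization.IsPeriod a₀ p ∧
        p ∣ Nat.lcm (n 0) (n (Fin.last k))) ∧
      (∀ᶠ x : ℕ in atTop,
        ((NumericalFactorization.lengthSet n x).ncard : ℚ) = a₁ * (x : ℚ) + a₀ x) ∧
      (Γ ≠ ⊤ → ∃ g : ℕ, IsLeast (NumericalFactorization.deltaSet Γ n) g ∧
        a₁ = ((n (Fin.last k) : ℚ) - (n 0 : ℚ)) /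
          ((g : ℚ) * (n 0 : ℚ) * (n (Fin.last k) : ℚ))) := by
  have hmono : Monotone n := hn.strictMono.monotone
  have hpos := hn.pos
  have hlcm : 0 < Nat.lcm (n 0) (n (Fin.last k)) := Nat.lcm_pos (hpos 0) (hpos _)
  rcases (hmono (Fin.zero_le (Fin.last k))).eq_or_lt with heq | hlt
  -- A single generator must be `1`, so `Γ = ⊤` and each `x` has the one length `x`.
  · have hk : k = 0 := by
      simpa using (congrArg Fin.val (hn.strictMono.injective heq)).symm
    subst hk
    have h1 : n 0 = 1 := eq_one_of_forall_dvd hΓ hn fun i => by rw [show i = 0 from Fin.ext (by omega)]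
    have hΓtop : Γ = ⊤ := by
      rw [← hn.closure_eq, eq_top_iff]
      rintro x -
      exact mem_closure_of_mem_lengthSet (l := x)
        (mem_lengthSet.2 ⟨fun _ => x, by simp [h1], by simp⟩)
    obtain ⟨a₀, hp, ha⟩ := exists_periodic_of_eventually_add (F := fun x =>
      ((lengthSet n x).ncard : ℚ)) (c := 0) (N := 0) hlcm (fun x _ => by
        have : ∀ y, lengthSet n y = {y} := by
          intro y
          ext l
          rw [mem_lengthSet, Set.mem_singleton_iff]
          constructor
          · rintro ⟨a, rfl, rfl⟩
            simp [h1]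
          · rintro rfl
            exact ⟨fun _ => l, by simp [h1], by simp⟩
        simp [this])
    exact ⟨0, a₀, hp, ha, fun h => (h hΓtop).elim⟩
  · obtain ⟨g, hg⟩ := exists_isDifferenceGcd hΓ hn hlt
    obtain ⟨a, ha⟩ := Nat.dvd_lcm_left (n 0) (n (Fin.last k))
    obtain ⟨b, hb⟩ := Nat.dvd_lcm_right (n 0) (n (Fin.last k))
    generalize Nat.lcm (n 0) (n (Fin.last k)) = q at *
    have hab : a * n 0 = b * n (Fin.last k) := by
      rw [mul_comm, ← ha, hb, mul_comm]
    have hba : b ≤ a := by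
      refine le_of_mul_le_mul_right ?_ (hpos 0)
      rw [hab]
      exact Nat.mul_le_mul_left b hlt.le
    obtain ⟨m, hm⟩ : g ∣ a - b := by
      have h1 : (b : ℤ) * n (Fin.last k) = a * n 0 := by exact_mod_cast hab.symm
      have h2 : (g : ℤ) ∣ (a : ℤ) - b := by
        refine hg.coprime.dvd_of_dvd_mul_right ?_
        rw [show ((a : ℤ) - b) * n 0 = (n (Fin.last k) - n 0) * b by linear_combination -h1]
        exact (hg.dvd _).mul_right _
      rw [← Nat.cast_sub hba] at h2
      exact Int.natCast_dvd_natCast.1 h2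
    have hm' : a = b + g * m := by omega
    obtain ⟨N, hN⟩ := ncard_lengthSet_add hg hmono (hpos 0) hlt hab hm'
    obtain ⟨a₀, hp, ha₀⟩ := exists_periodic_of_eventually_add (F := fun x =>
      ((lengthSet n x).ncard : ℚ)) (c := ((n (Fin.last k) : ℚ) - (n 0 : ℚ)) /
        ((g : ℚ) * (n 0 : ℚ) * (n (Fin.last k) : ℚ))) (N := N) hlcm (fun x hx => by
        have h := hN x hx
        rw [mul_comm a, ← ha] at h
        rw [h, Nat.cast_add, add_right_inj]
        have hg0 : (g : ℚ) ≠ 0 := by exact_mod_cast hg.pos.ne'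
        have h0 : (n 0 : ℚ) ≠ 0 := by exact_mod_cast (hpos 0).ne'
        have h1 : (n (Fin.last k) : ℚ) ≠ 0 := by exact_mod_cast (hpos _).ne'
        have hmq : (a : ℚ) = b + g * m := by exact_mod_cast hm'
        have habq : (a : ℚ) * n 0 = b * n (Fin.last k) := by exact_mod_cast hab
        rw [ha]
        push_cast
        field_simp
        linear_combination (-(n (Fin.last k)) : ℚ) * hmq + habq)
    exact ⟨_, a₀, hp, ha₀, fun _ => ⟨g, isLeast_deltaSet hn.closure_eq hg hmono hlt, rfl⟩⟩
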